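/- Let $m,s\ge 1$ and let $X_1,\dots,X_m\in\mathbb Z^s$ be (not necessarily distinct) vectors that are $\eta$-coplanar for some $\eta\in\mathbb R^s$, i.e. $\langle \eta,X_j\rangle=1$ for $j=1,\dots,m$. Let $\mathcal J=X_1\mathbb N+\dots+X_m\mathbb N$ (with $0\in\mathbb N$) and let $\mathbf C_X=\{\sum_j c_jX_j : c_j\ge 0\}$ be the convex cone generated by the $X_j$. For $z\in\mathcal J$ let $\mathbf m(z)$ be the number of finite words $i_1\cdots i_n$ ($n\ge 0$) over $\{1,\dots,m\}$ with $X_{i_1}+\dots+X_{i_n}=z$, and for $x\in\mathbf C_X$ put $$\mathbf m(x)=\min\{\mathbf m(z): z\in\mathcal J,\ \|x-z\|=d(x,\mathcal J)\},$$ where $\|\cdot\|$ is the Euclidean norm and $d(x,\mathcal J)=\min_{z\in\mathcal J}\|x-z\|$. Then for every unit vector $\theta\in\mathbf C_X$ the limit $$\gamma(\theta)=\lim_{k\to\infty}\frac{\log \mathbf m(k\theta)}{k}$$ (over positive integers $k$) exists, $\langle\theta,\eta\rangle>0$, and $$\gamma(\theta)=\langle\theta,\eta\rangle\,\sup\Big\{h(p):\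 p_1X_1+\dots+p_mX_m=\frac{\theta}{\langle\theta,\eta\rangle}\Big\},$$ where $p=(p_1,\dots,p_m)$ ranges over probability vectors, $h(p)=-\sum_{j=1}^m p_j\log p_j$ (with $0\log 0=0$), and the set of which the supremum is taken is non-empty and bounded above. -/

import Mathlib

open Filter Topology

noncomputable section

namespace LatticeWalk

variable {m s : ℕ}

/-- An integral vector, regarded as a vector of the Euclidean space `ℝ^s`. -/
def toEuclid (v : Fin s → ℤ) : EuclideanSpace ℝ (Fin s) :=
  WithLp.toLp 2 (fun i => (v i : ℝ))

/-- The semigroup `X_1 ℕ + ⋯ + X_m ℕ`. -/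
def semigroup (X : Fin m → Fin s → ℤ) : Set (Fin s → ℤ) :=
  {z | ∃ u : Fin m → ℕ, z = ∑ j, u j • X j}

/-- The convex cone `X_1 ℝ⁺ + ⋯ + X_m ℝ⁺`. -/
def cone (X : Fin m → Fin s → ℤ) : Set (EuclideanSpace ℝ (Fin s)) :=
  {x | ∃ c : Fin m → ℝ, (∀ j, 0 ≤ c j) ∧ x = ∑ j, c j • toEuclid (X j)}

/-- The position `X_{i_1} + ⋯ + X_{i_n}` reached by the word `i_1 … i_n`. -/
def walk (X : Fin m → Fin s → ℤ) (w : List (Fin m)) : Fin s → ℤ :=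
  (w.map X).sum

/-- The number of words (of any length) over `{1, …, m}` that reach the lattice point `z`. -/
def latticeMultiplicity (X : Fin m → Fin s → ℤ) (z : Fin s → ℤ) : ℕ :=
  Set.ncard {w : List (Fin m) | walk X w = z}

/-- The points of the semigroup that are nearest to `x`. -/
def nearest (X : Fin m → Fin s → ℤ) (x : EuclideanSpace ℝ (Fin s)) : Set (Fin s → ℤ) :=
  {z | z ∈ semigroup X ∧
    ‖x - toEuclid z‖ = Metric.infDist x (toEuclid '' semigroup X)}

/-- The multiplicity of a real point: the least multiplicity of a point of the semigroup
nearest to it. -/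
def multiplicity (X : Fin m → Fin s → ℤ) (x : EuclideanSpace ℝ (Fin s)) : ℕ :=
  sInf (latticeMultiplicity X '' nearest X x)

/-- The sequence `log 𝐦(kθ) / k`. -/
def growthSeq (X : Fin m → Fin s → ℤ) (θ : EuclideanSpace ℝ (Fin s)) (k : ℕ) : ℝ :=
  Real.log (multiplicity X ((k : ℝ) • θ) : ℝ) / (k : ℝ)

/-- The directional growth function `γ(θ) = lim_{k → ∞} log 𝐦(kθ) / k`. -/
def directionalGrowth (X : Fin m → Fin s → ℤ) (θ : EuclideanSpace ℝ (Fin s)) : ℝ :=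
  limUnder atTop (growthSeq X θ)

/-- `X_1, …, X_m` lie on the hyperplane `⟨η, x⟩ = 1`. -/
def IsCoplanar (X : Fin m → Fin s → ℤ) (η : EuclideanSpace ℝ (Fin s)) : Prop :=
  ∀ j, inner ℝ η (toEuclid (X j)) = 1

/-- The entropy of a probability vector (`0 log 0 = 0`). -/
def entropy (p : Fin m → ℝ) : ℝ := -∑ j, p j * Real.log (p j)

/-- The entropies of the probability vectors `p` with barycenter `∑ p_j X_j = β`. -/
def entropySet (X : Fin m → Fin s → ℤ) (β : EuclideanSpace ℝ (Fin s)) : Set ℝ :=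
  {h | ∃ p ∈ stdSimplex ℝ (Fin m), ∑ j, p j • toEuclid (X j) = β ∧ h = entropy p}

end LatticeWalk

end

/-! Coplanarity forces every word reaching `z` to have length `n = ⟨η, z⟩`, so its multiplicity is a
sum of at most `(n + 1) ^ m` multinomials (`latticeMultiplicity_eq`). By Stirling each logarithm is
`homEntropy u + O(log n)`, and `homEntropy` is continuous and homogeneous of degree 1. Hence `log
𝐦(kθ) / k` is asymptotically the maximum of `homEntropy (u / k)` over integral representations `u`
of a point near `kθ`. Upper bound: by compactness, the `u / k` accumulate only at nonnegative real
representations of `θ`. Lower bound: a maximizing real representation `c` must be a limit of such `u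
/ k`, whatever the nearby points are (`exists_representations_tendsto`). Indeed, if the
representation closest to `k c` stayed far from it, an integral relation could be subtracted to
bring it closer. -/

namespace LatticeWalk

variable {m s : ℕ}

/-! ### Integral relations from real ones -/

/-- Simultaneous Diophantine approximation by one common multiplier. -/
theorem exists_nat_mul_near_int (d : Fin m → ℝ) {ε : ℝ} (hε : 0 < ε) :
    ∃ N : ℕ, 0 < N ∧ ∃ g : Fin m → ℤ, ∀ j, |N * d j - g j| < ε := by
  obtain ⟨a, -, φ, hφ, ha⟩ := (isCompact_univ_pi fun _ : Fin m => isCompact_Icc).tendsto_subseq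
    (x := fun n : ℕ => fun j => Int.fract ((n : ℝ) * d j)) (s := Set.pi Set.univ fun _ => Set.Icc 0 1)
    fun n j _ => ⟨Int.fract_nonneg _, (Int.fract_lt_one _).le⟩
  -- Pigeonhole: two fractional-part vectors are close, and the difference of their indices is the
  -- multiplier.
  obtain ⟨n₀, hn₀⟩ := Metric.cauchySeq_iff.1 ha.cauchySeq ε hε
  have hlt := hφ (Nat.lt_succ_self n₀)
  refine ⟨φ (n₀ + 1) - φ n₀, Nat.sub_pos_of_lt hlt,
    fun j => ⌊(φ (n₀ + 1) : ℝ) * d j⌋ - ⌊(φ n₀ : ℝ) * d j⌋, fun j => ?_⟩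
  have h := (dist_le_pi_dist _ _ j).trans_lt (hn₀ (n₀ + 1) (by omega) n₀ le_rfl)
  rw [Real.dist_eq] at h
  simp only [Function.comp_apply, Int.fract] at h
  rw [Nat.cast_sub hlt.le]
  push_cast
  rw [show ∀ a b x y d : ℝ, (a - b) * d - (x - y) = a * d - x - (b * d - y) by intros; ring]
  exact h

/-- A nonzero real relation between integral vectors can be replaced by an integral one with
compatible signs. -/
theorem exists_int_relation (X : Fin m → Fin s → ℤ) (d : Fin m → ℝ) (hd : d ≠ 0)
    (hX : ∑ j, d j • toEuclid (X j) = 0) :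
    ∃ g : Fin m → ℤ, g ≠ 0 ∧ ∑ j, g j • X j = 0 ∧
      ∀ j, (0 < g j → 0 < d j) ∧ (g j < 0 → d j < 0) := by
  obtain ⟨j₀, hj₀⟩ : ∃ j, d j ≠ 0 := by
    by_contra! h
    exact hd (funext h)
  set S : ℝ := ∑ j, ∑ i, |(X j i : ℝ)| with hS
  have hS0 : 0 ≤ S := by positivity
  -- The bound `|d j₀|` forces `g j₀ ≠ 0`; the bound `1 / (S + 1)` makes each integral coordinate of
  -- `∑ g j • X j` less than 1 in absolute value, hence 0.
  have hε : 0 < min |d j₀| (1 / (S + 1)) := lt_min (abs_pos.2 hj₀) (by positivity)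
  obtain ⟨N, hN, g, hg⟩ := exists_nat_mul_near_int d hε
  have hN1 : (1 : ℝ) ≤ N := by exact_mod_cast hN
  have hg1 : ∀ j, |N * d j - g j| < 1 := fun j =>
    (hg j).trans_le ((min_le_right _ _).trans ((div_le_one (by positivity)).2 (by linarith)))
  refine ⟨g, fun h0 => ?_, ?_, fun j => ⟨fun h => ?_, fun h => ?_⟩⟩
  · have h := (hg j₀).trans_le (min_le_left _ _)
    rw [h0] at h
    simp only [Pi.zero_apply, Int.cast_zero, sub_zero, abs_mul, Nat.abs_cast] at h
    nlinarith [abs_nonneg (d j₀)]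
  · ext i
    have hXi : ∑ j, d j * (X j i : ℝ) = 0 := by
      have := congrArg (fun v : EuclideanSpace ℝ (Fin s) => v i) hX
      simpa [toEuclid] using this
    have hcast : (((∑ j, g j • X j) i : ℤ) : ℝ) = ∑ j, (g j - N * d j) * (X j i : ℝ) := by
      simp only [Finset.sum_apply, Pi.smul_apply, smul_eq_mul, sub_mul, Finset.sum_sub_distrib,
        mul_assoc, ← Finset.mul_sum, hXi]
      push_cast
      ring
    have hlt : |(((∑ j, g j • X j) i : ℤ) : ℝ)| < 1 := by
      rw [hcast]
      calc |∑ j, (g j - N * d j) * (X j i : ℝ)|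
          ≤ ∑ j, |(g j - N * d j) * (X j i : ℝ)| := Finset.abs_sum_le_sum_abs _ _
        _ ≤ ∑ j, 1 / (S + 1) * ∑ i, |(X j i : ℝ)| := by
            refine Finset.sum_le_sum fun j _ => ?_
            rw [abs_mul, abs_sub_comm]
            exact mul_le_mul ((hg j).le.trans (min_le_right _ _))
              (Finset.single_le_sum (f := fun i => |(X j i : ℝ)|) (fun i _ => abs_nonneg _)
                (Finset.mem_univ i)) (abs_nonneg _) (by positivity)
        _ = S / (S + 1) := by rw [← Finset.mul_sum, ← hS]; ring
        _ < 1 := (div_lt_one (by positivity)).2 (by linarith)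
    have h1 : |(∑ j, g j • X j) i| < 1 := by exact_mod_cast hlt
    simpa using Int.abs_lt_one_iff.1 h1
  · have h1 : (1 : ℝ) ≤ g j := by exact_mod_cast h
    have h2 := (abs_lt.1 (hg1 j)).1
    by_contra! h3
    nlinarith
  · have h1 : (g j : ℝ) ≤ -1 := by exact_mod_cast (by omega : g j ≤ -1)
    have h2 := (abs_lt.1 (hg1 j)).2
    by_contra! h3
    nlinarith

/-! ### Stirling bounds and entropy -/

theorem mul_log_sub_le_log_factorial (n : ℕ) :
    n * Real.log n - n ≤ Real.log (n.factorial : ℝ) := by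
  rcases Nat.eq_zero_or_pos n with rfl | hn
  · simp
  have hn' : (0 : ℝ) < n := by exact_mod_cast hn
  have hf : (0 : ℝ) < n.factorial := by exact_mod_cast n.factorial_pos
  have h := Real.log_le_log (by positivity) (Real.pow_div_factorial_le_exp _ hn'.le n)
  rw [Real.log_div (by positivity) hf.ne', Real.log_pow, Real.log_exp] at h
  linarith

theorem log_factorial_le (n : ℕ) :
    Real.log (n.factorial : ℝ) ≤ n * Real.log n - n + (1 + Real.log (n + 1)) := by
  -- The shift to `n + 1` makes the induction close: its step is `(n + 2) log ((n + 2) / (n + 1)) ≥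
  -- 1`.
  have key : ∀ n : ℕ, Real.log (n.factorial : ℝ) ≤ (n + 1) * Real.log (n + 1) - n := by
    intro n
    induction n with
    | zero => simp
    | succ n ih =>
      have hn : (0 : ℝ) ≤ n := n.cast_nonneg
      rw [Nat.factorial_succ, Nat.cast_mul, Real.log_mul (by positivity) (by positivity)]
      push_cast
      have h := Real.one_sub_inv_le_log_of_pos (x := ((n : ℝ) + 1 + 1) / (n + 1)) (by positivity)
      rw [Real.log_div (by positivity) (by positivity), inv_div] at h
      have h2 : (1 : ℝ) = (n + 1 + 1) * (1 - (n + 1) / (n + 1 + 1)) := by field_simp; ring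
      have h3 := mul_le_mul_of_nonneg_left h (by positivity : (0 : ℝ) ≤ n + 1 + 1)
      nlinarith
  refine (key n).trans ?_
  rcases Nat.eq_zero_or_pos n with rfl | hn
  · simp
  have hn' : (0 : ℝ) < n := by exact_mod_cast hn
  have h := Real.log_le_sub_one_of_pos (x := ((n : ℝ) + 1) / n) (by positivity)
  rw [Real.log_div (by positivity) (by positivity)] at h
  have h2 := mul_le_mul_of_nonneg_left h hn'.le
  have h3 : (n : ℝ) * ((n + 1) / n - 1) = 1 := by field_simp; ring
  nlinarith

/-- The positively homogeneous extension of the entropy. -/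
noncomputable def homEntropy (x : Fin m → ℝ) : ℝ :=
  (∑ j, x j) * Real.log (∑ j, x j) - ∑ j, x j * Real.log (x j)

theorem continuous_homEntropy : Continuous (homEntropy (m := m)) := by
  unfold homEntropy
  refine Continuous.sub (Real.continuous_mul_log.comp (by fun_prop)) ?_
  exact continuous_finsetSum _ fun j _ => Real.continuous_mul_log.comp (continuous_apply j)

theorem homEntropy_smul {r : ℝ} (hr : 0 < r) (x : Fin m → ℝ) :
    homEntropy (r • x) = r * homEntropy x := by
  have h : ∀ y : ℝ, r * y * Real.log (r * y) = r * Real.log r * y + r * (y * Real.log y) := by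
    intro y
    rcases eq_or_ne y 0 with rfl | hy
    · simp
    · rw [Real.log_mul hr.ne' hy]; ring
  simp only [homEntropy, Pi.smul_apply, smul_eq_mul, ← Finset.mul_sum, h, Finset.sum_add_distrib]
  ring

theorem homEntropy_eq_entropy {p : Fin m → ℝ} (hp : ∑ j, p j = 1) :
    homEntropy p = entropy p := by
  simp [homEntropy, entropy, hp]

/-- The linear Stirling terms cancel because `∑ u j = n`; one error remains for each of the `m + 1`
factorials. -/
theorem abs_log_multinomial_sub_le (u : Fin m → ℕ) :
    |Real.log (Nat.multinomial Finset.univ u : ℝ) - homEntropy (fun j => (u j : ℝ))| ≤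
      (m + 1) * (1 + Real.log ((∑ j, u j : ℕ) + 1)) := by
  set n := ∑ j, u j with hn
  have hspec : ∑ j, Real.log ((u j).factorial : ℝ) + Real.log (Nat.multinomial Finset.univ u : ℝ) =
      Real.log (n.factorial : ℝ) := by
    have hp : ∀ j ∈ Finset.univ, ((u j).factorial : ℝ) ≠ 0 := fun j _ => by positivity
    have hm : (Nat.multinomial Finset.univ u : ℝ) ≠ 0 := by
      exact_mod_cast (Nat.multinomial_pos Finset.univ u).ne'
    rw [← Real.log_prod hp, ← Real.log_mul (Finset.prod_ne_zero_iff.2 hp) hm, hn,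
      ← Nat.multinomial_spec]
    push_cast
    rfl
  have h1 := mul_log_sub_le_log_factorial n
  have h2 := log_factorial_le n
  have h3 : ∑ j, ((u j : ℝ) * Real.log (u j) - u j) ≤ ∑ j, Real.log ((u j).factorial : ℝ) :=
    Finset.sum_le_sum fun j _ => mul_log_sub_le_log_factorial (u j)
  have h4 : ∑ j, Real.log ((u j).factorial : ℝ) ≤
      ∑ j, ((u j : ℝ) * Real.log (u j) - u j + (1 + Real.log (n + 1))) := by
    refine Finset.sum_le_sum fun j _ => (log_factorial_le (u j)).trans ?_
    have : (u j : ℝ) ≤ n := by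
      exact_mod_cast Finset.single_le_sum (f := u) (fun i _ => Nat.zero_le _) (Finset.mem_univ j)
    gcongr
  rw [Finset.sum_sub_distrib] at h3
  rw [Finset.sum_add_distrib, Finset.sum_sub_distrib, Finset.sum_const, Finset.card_univ,
    Fintype.card_fin, nsmul_eq_mul] at h4
  have hc : ∑ j, (u j : ℝ) = n := by rw [hn]; push_cast; rfl
  have hL : 0 ≤ Real.log ((n : ℝ) + 1) := Real.log_nonneg (by simp)
  have hmL : 0 ≤ (m : ℝ) * (1 + Real.log ((n : ℝ) + 1)) := by positivity
  rw [hc] at h3 h4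
  simp only [homEntropy, hc]
  rw [abs_le]
  constructor <;> linarith

/-! ### Counting words by representations -/

theorem toEuclid_sum (X : Fin m → Fin s → ℤ) (u : Fin m → ℕ) :
    toEuclid (∑ j, u j • X j) = ∑ j, (u j : ℝ) • toEuclid (X j) := by
  ext i
  simp [toEuclid]

theorem inner_sum_eq {X : Fin m → Fin s → ℤ} {η : EuclideanSpace ℝ (Fin s)}
    (hX : IsCoplanar X η) (c : Fin m → ℝ) :
    inner ℝ η (∑ j, c j • toEuclid (X j)) = ∑ j, c j := by
  rw [inner_sum]
  exact Finset.sum_congr rfl fun j _ => by rw [inner_smul_right, hX j, mul_one]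

theorem inner_toEuclid_sum {X : Fin m → Fin s → ℤ} {η : EuclideanSpace ℝ (Fin s)}
    (hX : IsCoplanar X η) (u : Fin m → ℕ) :
    inner ℝ η (toEuclid (∑ j, u j • X j)) = (∑ j, u j : ℕ) := by
  rw [toEuclid_sum, inner_sum_eq hX]
  push_cast
  rfl

theorem walk_ofFn (X : Fin m → Fin s → ℤ) {n : ℕ} (f : Fin n → Fin m) :
    walk X (List.ofFn f) = ∑ i, X (f i) := by
  simp [walk, List.map_ofFn, List.sum_ofFn]

theorem inner_walk {X : Fin m → Fin s → ℤ} {η : EuclideanSpace ℝ (Fin s)}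
    (hX : IsCoplanar X η) (w : List (Fin m)) :
    inner ℝ η (toEuclid (walk X w)) = (w.length : ℝ) := by
  have h : toEuclid (walk X w) = (w.map fun j => toEuclid (X j)).sum := by
    induction w with
    | nil => ext i; simp [walk, toEuclid]
    | cons a w ih =>
      rw [List.map_cons, List.sum_cons, ← ih]
      ext i
      simp [walk, toEuclid]
  rw [h]
  clear h
  induction w with
  | nil => simp
  | cons a w ih =>
    rw [List.map_cons, List.sum_cons, inner_add_right, ih, hX a]
    simp [add_comm]

/-- The representations of a lattice point by `n` generators. -/
noncomputable def representations (X : Fin m → Fin s → ℤ) (n : ℕ) (z : Fin s → ℤ) :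
    Finset (Fin m → ℕ) :=
  {u ∈ Finset.piAntidiag Finset.univ n | ∑ j, u j • X j = z}

theorem mem_representations {X : Fin m → Fin s → ℤ} {n : ℕ} {z : Fin s → ℤ} {u : Fin m → ℕ} :
    u ∈ representations X n z ↔ ∑ j, u j = n ∧ ∑ j, u j • X j = z := by
  simp [representations]

theorem card_representations_le (X : Fin m → Fin s → ℤ) (n : ℕ) (z : Fin s → ℤ) :
    (representations X n z).card ≤ (n + 1) ^ m := by
  have h : representations X n z ⊆ Fintype.piFinset fun _ => Finset.range (n + 1) := by
    intro u hu
    rw [mem_representations] at hu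
    rw [Fintype.mem_piFinset]
    intro j
    have := Finset.single_le_sum (f := u) (fun i _ => Nat.zero_le _) (Finset.mem_univ j)
    rw [Finset.mem_range]
    omega
  simpa using Finset.card_le_card h

open Classical in
-- Both sides are the coefficient at `z` of `(∑ e (X j)) ^ n` in the group semiring of `ℤ^s`,
-- expanded as words and by the multinomial theorem.
theorem card_functions_eq (X : Fin m → Fin s → ℤ) (n : ℕ) (z : Fin s → ℤ) :
    Finset.card {f : Fin n → Fin m | ∑ i, X (f i) = z} =
      ∑ u ∈ representations X n z, Nat.multinomial Finset.univ u := by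
  let e : (Fin s → ℤ) → AddMonoidAlgebra ℕ (Fin s → ℤ) := fun v => AddMonoidAlgebra.single v 1
  have hprod : ∀ {ι : Type} (S : Finset ι) (v : ι → Fin s → ℤ),
      ∏ i ∈ S, e (v i) = e (∑ i ∈ S, v i) := by
    intro ι S v
    induction S using Finset.induction_on with
    | empty => simp [e, AddMonoidAlgebra.one_def]
    | insert a S ha ih =>
      rw [Finset.prod_insert ha, Finset.sum_insert ha, ih]
      simp [e, AddMonoidAlgebra.single_mul_single]
  have h1 : (∑ j, e (X j)) ^ n = ∑ f : Fin n → Fin m, e (∑ i, X (f i)) := by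
    rw [Fintype.sum_pow]
    exact Finset.sum_congr rfl fun f _ => hprod _ _
  have hpow : ∀ (v : Fin s → ℤ) (k : ℕ), e v ^ k = e (k • v) := by
    intro v k
    simp [e, AddMonoidAlgebra.single_pow]
  have h2 : (∑ j, e (X j)) ^ n = ∑ u ∈ Finset.piAntidiag Finset.univ n,
      (Nat.multinomial Finset.univ u) • e (∑ j, u j • X j) := by
    rw [Finset.sum_pow_eq_sum_piAntidiag]
    refine Finset.sum_congr rfl fun u _ => ?_
    rw [nsmul_eq_mul]
    congr 1
    rw [← hprod]
    exact Finset.prod_congr rfl fun j _ => hpow _ _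
  have h3 := congrArg (fun q => q.coeff z) (h1.symm.trans h2)
  simp only [e, AddMonoidAlgebra.coeff_sum, AddMonoidAlgebra.coeff_single,
    AddMonoidAlgebra.coeff_smul, Finsupp.finsetSum_apply, Finsupp.single_apply,
    Finsupp.smul_apply, smul_eq_mul, mul_ite, mul_one, mul_zero] at h3
  rw [Finset.card_filter, representations, Finset.sum_filter]
  exact h3

theorem latticeMultiplicity_eq {X : Fin m → Fin s → ℤ} {η : EuclideanSpace ℝ (Fin s)}
    (hX : IsCoplanar X η) {n : ℕ} {z : Fin s → ℤ} (hz : inner ℝ η (toEuclid z) = (n : ℝ)) :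
    latticeMultiplicity X z = ∑ u ∈ representations X n z, Nat.multinomial Finset.univ u := by
  classical
  rw [← card_functions_eq, latticeMultiplicity, ← Set.ncard_coe_finset,
    ← Set.ncard_image_of_injective _ (List.ofFn_injective (n := n))]
  congr 1
  ext w
  simp only [Set.mem_ofPred_eq, Finset.coe_filter, Finset.mem_univ, true_and, Set.mem_image]
  constructor
  · intro hw
    have hlen : w.length = n := by
      have := inner_walk hX w
      rw [hw, hz] at this
      exact_mod_cast this.symm
    subst hlen
    exact ⟨w.get, by rw [← walk_ofFn, List.ofFn_get, hw], List.ofFn_get w⟩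
  · rintro ⟨f, hf, rfl⟩
    rw [walk_ofFn, hf]

/-! ### Nearest points and rescaling -/

theorem nearest_nonempty (X : Fin m → Fin s → ℤ) (x : EuclideanSpace ℝ (Fin s)) :
    (nearest X x).Nonempty := by
  have hcl : IsClosed (toEuclid '' semigroup X) := by
    refine Metric.isClosed_of_pairwise_le_dist one_pos ?_
    rintro _ ⟨v, -, rfl⟩ _ ⟨w, -, rfl⟩ hvw
    obtain ⟨i, hi⟩ : ∃ i, v i ≠ w i := by
      by_contra! h
      exact hvw (by rw [funext h])
    have h1 : (1 : ℝ) ≤ |(v i : ℝ) - w i| := by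
      exact_mod_cast Int.one_le_abs (sub_ne_zero.2 hi)
    have h2 := PiLp.norm_apply_le (toEuclid v - toEuclid w) i
    rw [dist_eq_norm]
    exact h1.trans (by simpa [toEuclid] using h2)
  obtain ⟨_, ⟨z, hz, rfl⟩, h⟩ := hcl.exists_infDist_eq_dist
    (Set.Nonempty.image _ ⟨0, 0, by simp⟩) x
  exact ⟨z, hz, by rw [h, dist_eq_norm]⟩

theorem norm_sub_nearest_le {X : Fin m → Fin s → ℤ} {c : Fin m → ℝ} (hc : ∀ j, 0 ≤ c j)
    {z : Fin s → ℤ} (hz : z ∈ nearest X (∑ j, c j • toEuclid (X j))) :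
    ‖∑ j, c j • toEuclid (X j) - toEuclid z‖ ≤ ∑ j, ‖toEuclid (X j)‖ := by
  rw [hz.2]
  -- Rounding the coefficients down gives a semigroup point at a distance bounded independently of
  -- `c`.
  have hmem : toEuclid (∑ j, ⌊c j⌋₊ • X j) ∈ toEuclid '' semigroup X :=
    ⟨_, ⟨fun j => ⌊c j⌋₊, rfl⟩, rfl⟩
  refine (Metric.infDist_le_dist_of_mem hmem).trans ?_
  rw [dist_eq_norm, toEuclid_sum, ← Finset.sum_sub_distrib]
  refine (norm_sum_le _ _).trans (Finset.sum_le_sum fun j _ => ?_)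
  rw [← sub_smul, norm_smul, Real.norm_eq_abs]
  refine mul_le_of_le_one_left (norm_nonneg _) (abs_le.2 ⟨?_, ?_⟩)
  · linarith [Nat.floor_le (hc j)]
  · linarith [Nat.lt_floor_add_one (c j)]

theorem exists_nearest_multiplicity_eq (X : Fin m → Fin s → ℤ) (x : EuclideanSpace ℝ (Fin s)) :
    ∃ z ∈ nearest X x, multiplicity X x = latticeMultiplicity X z := by
  obtain ⟨z, hz, h⟩ := Nat.sInf_mem ((nearest_nonempty X x).image (latticeMultiplicity X))
  exact ⟨z, hz, h.symm⟩

theorem tendsto_inv_smul_of_norm_sub_le {θ : EuclideanSpace ℝ (Fin s)}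
    {y : ℕ → EuclideanSpace ℝ (Fin s)} {C : ℝ} (h : ∀ k : ℕ, ‖(k : ℝ) • θ - y k‖ ≤ C) :
    Tendsto (fun k : ℕ => (k : ℝ)⁻¹ • y k) atTop (𝓝 θ) := by
  rw [tendsto_iff_norm_sub_tendsto_zero]
  refine squeeze_zero' (Eventually.of_forall fun k => norm_nonneg _) ?_
    (tendsto_const_div_atTop_nhds_zero_nat C)
  filter_upwards [eventually_gt_atTop 0] with k hk
  have hk' : (0 : ℝ) < k := by exact_mod_cast hk
  rw [le_div_iff₀ hk', norm_sub_rev]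
  calc ‖θ - (k : ℝ)⁻¹ • y k‖ * k = ‖(k : ℝ) • (θ - (k : ℝ)⁻¹ • y k)‖ := by
        rw [norm_smul, Real.norm_of_nonneg hk'.le, mul_comm]
    _ ≤ C := by rw [smul_sub, smul_inv_smul₀ hk'.ne']; exact h k

theorem tendsto_log_add_one_div {n : ℕ → ℕ} {t : ℝ} (ht : 0 < t)
    (hn : Tendsto (fun k : ℕ => (n k : ℝ) / k) atTop (𝓝 t)) :
    Tendsto (fun k : ℕ => Real.log ((n k : ℝ) + 1) / k) atTop (𝓝 0) := by
  have h1 : Tendsto (fun k : ℕ => ((n k : ℝ) + 1) / k) atTop (𝓝 t) := by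
    simpa [add_div] using hn.add (tendsto_const_div_atTop_nhds_zero_nat (1 : ℝ))
  have h2 : Tendsto (fun k : ℕ => (n k : ℝ) + 1) atTop atTop := by
    refine (h1.pos_mul_atTop ht (tendsto_natCast_atTop_atTop (R := ℝ))).congr' ?_
    filter_upwards [eventually_gt_atTop 0] with k hk
    have hk' : (0 : ℝ) < k := by exact_mod_cast hk
    field_simp
  have h3 : Tendsto (fun x : ℝ => Real.log x / x) atTop (𝓝 0) :=
    Real.isLittleO_log_id_atTop.tendsto_div_nhds_zero
  have h4 := (h3.comp h2).mul h1
  rw [zero_mul] at h4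
  refine h4.congr fun k => ?_
  have : (n k : ℝ) + 1 ≠ 0 := by positivity
  simp only [Function.comp_apply]
  field_simp

/-! ### Limits of rescaled representations -/

variable {X : Fin m → Fin s → ℤ} {η θ : EuclideanSpace ℝ (Fin s)} {z : ℕ → Fin s → ℤ}

theorem tendsto_length_div (hX : IsCoplanar X η)
    (hz : Tendsto (fun k : ℕ => (k : ℝ)⁻¹ • toEuclid (z k)) atTop (𝓝 θ))
    {u : ℕ → Fin m → ℕ} (hu : ∀ k, ∑ j, u k j • X j = z k) :
    Tendsto (fun k : ℕ => ((∑ j, u k j : ℕ) : ℝ) / k) atTop (𝓝 (inner ℝ η θ)) := by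
  refine ((tendsto_const_nhds (x := η)).inner hz).congr fun k => ?_
  rw [inner_smul_right, ← hu, inner_toEuclid_sum hX, div_eq_inv_mul]

/-- Rescaled representations accumulate at real representations of the limit direction. -/
theorem exists_subseq_tendsto (hX : IsCoplanar X η)
    (hz : Tendsto (fun k : ℕ => (k : ℝ)⁻¹ • toEuclid (z k)) atTop (𝓝 θ))
    {u : ℕ → Fin m → ℕ} (hu : ∀ k, ∑ j, u k j • X j = z k)
    {ns : ℕ → ℕ} (hns : Tendsto ns atTop atTop) :
    ∃ c : Fin m → ℝ, (∀ j, 0 ≤ c j) ∧ ∑ j, c j • toEuclid (X j) = θ ∧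
      ∃ φ : ℕ → ℕ, StrictMono φ ∧
        Tendsto (fun i : ℕ => fun j => (u (ns (φ i)) j : ℝ) / (ns (φ i) : ℝ)) atTop (𝓝 c) := by
  obtain ⟨B, hB⟩ := (tendsto_length_div hX hz hu).bddAbove_range
  obtain ⟨c, hc, φ, hφ, hlim⟩ := (isCompact_univ_pi fun _ : Fin m => isCompact_Icc).tendsto_subseq
    (x := fun i : ℕ => fun j => (u (ns i) j : ℝ) / (ns i : ℝ))
    (s := Set.pi Set.univ fun _ => Set.Icc 0 B)
    fun i j _ => ⟨by positivity, by
      refine le_trans ?_ (hB ⟨ns i, rfl⟩)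
      have : u (ns i) j ≤ ∑ j, u (ns i) j :=
        Finset.single_le_sum (f := u (ns i)) (fun _ _ => Nat.zero_le _) (Finset.mem_univ j)
      dsimp only
      gcongr⟩
  refine ⟨c, fun j => (hc j trivial).1, ?_, φ, hφ, hlim⟩
  have hcont : Continuous fun d : Fin m → ℝ => ∑ j, d j • toEuclid (X j) := by fun_prop
  refine tendsto_nhds_unique ((hcont.tendsto c).comp hlim)
    ((hz.comp (hns.comp hφ.tendsto_atTop)).congr fun i => ?_)
  simp only [Function.comp_apply]
  rw [← hu, toEuclid_sum, Finset.smul_sum]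
  exact Finset.sum_congr rfl fun j _ => by rw [smul_smul, div_eq_inv_mul]

/-- Any real representation of the limit direction is the limit of rescaled integral
representations. -/
theorem exists_representations_tendsto (hX : IsCoplanar X η)
    (hz : Tendsto (fun k : ℕ => (k : ℝ)⁻¹ • toEuclid (z k)) atTop (𝓝 θ))
    (hzX : ∀ k, z k ∈ semigroup X) {c : Fin m → ℝ} (hc : ∀ j, 0 ≤ c j)
    (hcθ : ∑ j, c j • toEuclid (X j) = θ) :
    ∃ u : ℕ → Fin m → ℕ, (∀ k, ∑ j, u k j • X j = z k) ∧
      Tendsto (fun k : ℕ => fun j => (u k j : ℝ) / (k : ℝ)) atTop (𝓝 c) := by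
  -- All representations of `z k` have the same length, so finitely many compete and one is
  -- `ℓ¹`-closest to `k c`.
  have hmin : ∀ k : ℕ, ∃ u : Fin m → ℕ, ∑ j, u j • X j = z k ∧
      ∀ v : Fin m → ℕ, ∑ j, v j • X j = z k →
        ∑ j, |(u j : ℝ) - k * c j| ≤ ∑ j, |(v j : ℝ) - k * c j| := by
    intro k
    obtain ⟨w, hw⟩ := hzX k
    have hlen : ∀ v : Fin m → ℕ, ∑ j, v j • X j = z k →
        v ∈ representations X (∑ j, w j) (z k) := by
      intro v hv
      rw [mem_representations]
      refine ⟨?_, hv⟩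
      have := (inner_toEuclid_sum hX v).symm.trans (by rw [hv, hw, inner_toEuclid_sum hX w])
      exact_mod_cast this
    obtain ⟨u, hu, h⟩ := Finset.exists_min_image (representations X (∑ j, w j) (z k))
      (fun v => ∑ j, |(v j : ℝ) - k * c j|) ⟨w, hlen w hw.symm⟩
    exact ⟨u, (mem_representations.1 hu).2, fun v hv => h v (hlen v hv)⟩
  choose u hu humin using hmin
  refine ⟨u, hu, tendsto_of_subseq_tendsto fun ns hns => ?_⟩
  obtain ⟨c', -, hc'θ, φ, hφ, hlim⟩ := exists_subseq_tendsto hX hz hu hns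
  suffices h : c' = c from ⟨φ, h ▸ hlim⟩
  by_contra hne
  obtain ⟨g, hg0, hgX, hg⟩ := exists_int_relation X (c' - c) (sub_ne_zero.2 hne) (by
    simp only [Pi.sub_apply, sub_smul, Finset.sum_sub_distrib, hcθ, hc'θ, sub_self])
  have hK : Tendsto (fun i => (ns (φ i) : ℝ)) atTop atTop :=
    tendsto_natCast_atTop_atTop.comp (hns.comp hφ.tendsto_atTop)
  have hdiff : ∀ j, Tendsto (fun i => (u (ns (φ i)) j : ℝ) / (ns (φ i) : ℝ) - c j) atTop
      (𝓝 (c' j - c j)) := fun j => ((tendsto_pi_nhds.1 hlim) j).sub_const _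
  -- Where `g j ≠ 0`, the deviation `u j - K c j` grows like `K (c' j - c j)`, with the sign of `g
  -- j`, so it eventually exceeds `|g j|`.
  have hev : ∀ᶠ i in atTop, 0 < (ns (φ i) : ℝ) ∧ ∀ j,
      (0 < g j → (g j : ℝ) ≤ u (ns (φ i)) j - ns (φ i) * c j) ∧
      (g j < 0 → u (ns (φ i)) j - ns (φ i) * c j ≤ (g j : ℝ)) := by
    refine (hK.eventually_gt_atTop 0).and (eventually_all.2 fun j => ?_)
    refine Filter.Eventually.and ?_ ?_
    · rcases lt_or_ge 0 (g j) with h | h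
      · filter_upwards [((hdiff j).pos_mul_atTop ((hg j).1 h) hK).eventually_ge_atTop (g j : ℝ),
          hK.eventually_gt_atTop 0] with i hi hi0 _
        rw [sub_mul, div_mul_cancel₀ _ hi0.ne'] at hi
        linarith
      · exact Eventually.of_forall fun i h' => absurd h' h.not_gt
    · rcases lt_or_ge (g j) 0 with h | h
      · filter_upwards [((hdiff j).neg_mul_atTop ((hg j).2 h) hK).eventually_le_atBot (g j : ℝ),
          hK.eventually_gt_atTop 0] with i hi hi0 _
        rw [sub_mul, div_mul_cancel₀ _ hi0.ne'] at hi
        linarith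
      · exact Eventually.of_forall fun i h' => absurd h' h.not_gt
  obtain ⟨i, hi0, hi⟩ := hev.exists
  set K := ns (φ i)
  have hpos : ∀ j, 0 ≤ (u K j : ℤ) - g j := by
    intro j
    rcases lt_or_ge 0 (g j) with h | h
    · have h1 := (hi j).1 h
      have h2 := mul_nonneg hi0.le (hc j)
      have h3 : (g j : ℝ) ≤ (u K j : ℤ) := by push_cast; linarith
      have h4 : g j ≤ (u K j : ℤ) := by exact_mod_cast h3
      omega
    · omega
  set v : Fin m → ℕ := fun j => ((u K j : ℤ) - g j).toNat with hv
  have hvZ : ∀ j, ((v j : ℕ) : ℤ) = (u K j : ℤ) - g j := fun j => Int.toNat_of_nonneg (hpos j)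
  have hvR : ∀ j, (v j : ℝ) = (u K j : ℝ) - g j := fun j => by exact_mod_cast hvZ j
  have hvX : ∑ j, v j • X j = z K := by
    have : ∀ w : Fin m → ℕ, ∑ j, w j • X j = ∑ j, ((w j : ℕ) : ℤ) • X j := fun w =>
      Finset.sum_congr rfl fun j _ => (natCast_zsmul _ _).symm
    rw [this]
    simp only [hvZ, sub_smul, Finset.sum_sub_distrib, hgX, sub_zero]
    rw [← this, hu]
  refine (humin K v hvX).not_gt ?_
  -- Subtracting `g` never overshoots `K c`, so each distance drops by exactly `|g j|`,
  -- contradicting minimality.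
  have hterm : ∀ j, |(v j : ℝ) - K * c j| = |(u K j : ℝ) - K * c j| - |(g j : ℝ)| := by
    intro j
    rw [hvR]
    rcases lt_trichotomy (g j) 0 with h | h | h
    · have h1 := (hi j).2 h
      have h2 : (g j : ℝ) < 0 := by exact_mod_cast h
      rw [abs_of_neg h2, abs_of_nonpos (by linarith), abs_of_nonpos (by linarith)]
      ring
    · simp [h]
    · have h1 := (hi j).1 h
      have h2 : (0 : ℝ) < g j := by exact_mod_cast h
      rw [abs_of_pos h2, abs_of_nonneg (by linarith), abs_of_nonneg (by linarith)]
      ring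
  simp only [hterm, Finset.sum_sub_distrib]
  obtain ⟨j₀, hj₀⟩ : ∃ j, g j ≠ 0 := by
    by_contra! h
    exact hg0 (funext h)
  have : 0 < ∑ j, |(g j : ℝ)| :=
    Finset.sum_pos' (fun j _ => abs_nonneg _) ⟨j₀, Finset.mem_univ _, by simpa using hj₀⟩
  linarith

/-! ### The growth rate -/

theorem homEntropy_div {k : ℕ} (hk : 0 < k) (u : Fin m → ℕ) :
    homEntropy (fun j => (u j : ℝ) / k) = homEntropy (fun j => (u j : ℝ)) / k := by
  have hk' : (0 : ℝ) < (k : ℝ)⁻¹ := by positivity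
  rw [div_eq_inv_mul, ← homEntropy_smul hk']
  congr 1
  ext j
  simp [div_eq_inv_mul]

theorem log_multiplicity_ge (hX : IsCoplanar X η) {y : Fin s → ℤ} {u : Fin m → ℕ}
    (hu : ∑ j, u j • X j = y) :
    homEntropy (fun j => (u j : ℝ)) - (m + 1) * (1 + Real.log ((∑ j, u j : ℕ) + 1)) ≤
      Real.log (latticeMultiplicity X y : ℝ) := by
  have h1 := (abs_le.1 (abs_log_multinomial_sub_le u)).1
  have h2 : Nat.multinomial Finset.univ u ≤ latticeMultiplicity X y := by
    rw [latticeMultiplicity_eq hX (by rw [← hu, inner_toEuclid_sum hX u])]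
    exact Finset.single_le_sum (f := Nat.multinomial Finset.univ) (fun _ _ => Nat.zero_le _)
      (mem_representations.2 ⟨rfl, hu⟩)
  have h3 : Real.log (Nat.multinomial Finset.univ u : ℝ) ≤ Real.log (latticeMultiplicity X y : ℝ) :=
    Real.log_le_log (by exact_mod_cast Nat.multinomial_pos Finset.univ u) (by exact_mod_cast h2)
  linarith

theorem exists_log_multiplicity_le (hX : IsCoplanar X η) {y : Fin s → ℤ} (hy : y ∈ semigroup X) :
    ∃ u : Fin m → ℕ, ∑ j, u j • X j = y ∧ Real.log (latticeMultiplicity X y : ℝ) ≤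
      homEntropy (fun j => (u j : ℝ)) + m * Real.log ((∑ j, u j : ℕ) + 1) +
        (m + 1) * (1 + Real.log ((∑ j, u j : ℕ) + 1)) := by
  obtain ⟨w, hw⟩ := hy
  set n := ∑ j, w j with hn
  have hw' : w ∈ representations X n y := mem_representations.2 ⟨rfl, hw.symm⟩
  obtain ⟨u, hu, hmax⟩ := Finset.exists_max_image (representations X n y)
    (Nat.multinomial Finset.univ) ⟨w, hw'⟩
  obtain ⟨hun, huy⟩ := mem_representations.1 hu
  refine ⟨u, huy, ?_⟩
  have h1 := (abs_le.1 (abs_log_multinomial_sub_le u)).2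
  rw [hun] at h1 ⊢
  have heq := latticeMultiplicity_eq hX (n := n) (z := y) (by rw [hw, inner_toEuclid_sum hX w])
  have h2 : latticeMultiplicity X y ≤ (n + 1) ^ m * Nat.multinomial Finset.univ u := by
    rw [heq]
    refine (Finset.sum_le_card_nsmul _ _ _ hmax).trans ?_
    rw [smul_eq_mul]
    exact Nat.mul_le_mul_right _ (card_representations_le X n y)
  have hpos : 0 < latticeMultiplicity X y := by
    rw [heq]
    exact Finset.sum_pos (fun v _ => Nat.multinomial_pos _ _) ⟨w, hw'⟩
  have hmu : (Nat.multinomial Finset.univ u : ℝ) ≠ 0 := by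
    exact_mod_cast (Nat.multinomial_pos Finset.univ u).ne'
  have h3 : Real.log (latticeMultiplicity X y : ℝ) ≤
      m * Real.log ((n : ℝ) + 1) + Real.log (Nat.multinomial Finset.univ u : ℝ) := by
    rw [← Real.log_pow, ← Real.log_mul (by positivity) hmu]
    exact Real.log_le_log (by exact_mod_cast hpos) (by exact_mod_cast h2)
  linarith

theorem tendsto_growthSeq (hX : IsCoplanar X η) {c : Fin m → ℝ} (hc : ∀ j, 0 ≤ c j)
    (hcθ : ∑ j, c j • toEuclid (X j) = θ) (hpos : 0 < inner ℝ η θ)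
    (hmax : ∀ d : Fin m → ℝ, (∀ j, 0 ≤ d j) → ∑ j, d j • toEuclid (X j) = θ →
      homEntropy d ≤ homEntropy c) :
    Tendsto (growthSeq X θ) atTop (𝓝 (homEntropy c)) := by
  -- Only the bounded distance of `z k` from `kθ` matters below, not which nearest point attains the
  -- minimum.
  choose z hz hmz using fun k : ℕ => exists_nearest_multiplicity_eq X ((k : ℝ) • θ)
  have hzθ : Tendsto (fun k : ℕ => (k : ℝ)⁻¹ • toEuclid (z k)) atTop (𝓝 θ) := by
    refine tendsto_inv_smul_of_norm_sub_le (C := ∑ j, ‖toEuclid (X j)‖) fun k => ?_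
    have h : (k : ℝ) • θ = ∑ j, ((k : ℝ) * c j) • toEuclid (X j) := by
      rw [← hcθ, Finset.smul_sum]
      exact Finset.sum_congr rfl fun j _ => smul_smul _ _ _
    have h2 := hz k
    rw [h] at h2 ⊢
    exact norm_sub_nearest_le (fun j => mul_nonneg k.cast_nonneg (hc j)) h2
  obtain ⟨u, hu, hulim⟩ := exists_representations_tendsto hX hzθ (fun k => (hz k).1) hc hcθ
  choose v hv hvle using fun k => exists_log_multiplicity_le hX (hz k).1
  have hue := tendsto_log_add_one_div hpos (tendsto_length_div hX hzθ hu)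
  have hve := tendsto_log_add_one_div hpos (tendsto_length_div hX hzθ hv)
  have h1 : Tendsto (fun k : ℕ => (1 : ℝ) / k) atTop (𝓝 0) :=
    tendsto_const_div_atTop_nhds_zero_nat 1
  have hlow : Tendsto (fun k : ℕ => homEntropy (fun j => (u k j : ℝ) / k) -
      (m + 1) * ((1 : ℝ) / k + Real.log ((∑ j, u k j : ℕ) + 1) / k)) atTop
      (𝓝 (homEntropy c)) := by
    simpa using ((continuous_homEntropy.tendsto c).comp hulim).sub
      ((h1.add hue).const_mul ((m : ℝ) + 1))
  have hupe : Tendsto (fun k : ℕ => m * (Real.log ((∑ j, v k j : ℕ) + 1) / k) +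
      (m + 1) * ((1 : ℝ) / k + Real.log ((∑ j, v k j : ℕ) + 1) / k)) atTop (𝓝 0) := by
    simpa using (hve.const_mul (m : ℝ)).add ((h1.add hve).const_mul ((m : ℝ) + 1))
  refine tendsto_of_subseq_tendsto fun ns hns => ?_
  obtain ⟨d, hd, hdθ, φ, hφ, hdlim⟩ := exists_subseq_tendsto hX hzθ hv hns
  have hsub : Tendsto (fun i => ns (φ i)) atTop atTop := hns.comp hφ.tendsto_atTop
  -- The limit point `d` need not be a maximizer; taking the maximum with `homEntropy c` gives an
  -- upper bound with the desired limit.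
  have hup : Tendsto (fun i : ℕ => max (homEntropy (fun j => (v (ns (φ i)) j : ℝ) / ns (φ i)))
      (homEntropy c) + (m * (Real.log ((∑ j, v (ns (φ i)) j : ℕ) + 1) / ns (φ i)) +
      (m + 1) * ((1 : ℝ) / ns (φ i) + Real.log ((∑ j, v (ns (φ i)) j : ℕ) + 1) / ns (φ i))))
      atTop (𝓝 (homEntropy c)) := by
    simpa [max_eq_right (hmax d hd hdθ)] using (((continuous_homEntropy.tendsto d).comp hdlim).max
      (tendsto_const_nhds (x := homEntropy c))).add (hupe.comp hsub)
  refine ⟨φ, tendsto_of_tendsto_of_tendsto_of_le_of_le' (hlow.comp hsub) hup ?_ ?_⟩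
  · filter_upwards [hsub.eventually_gt_atTop 0] with i hi
    have hi' : (0 : ℝ) < ns (φ i) := by exact_mod_cast hi
    simp only [Function.comp_apply, growthSeq]
    rw [homEntropy_div hi, hmz, ← add_div, ← mul_div_assoc, ← sub_div]
    gcongr
    exact log_multiplicity_ge hX (hu _)
  · filter_upwards [hsub.eventually_gt_atTop 0] with i hi
    have hi' : (0 : ℝ) < ns (φ i) := by exact_mod_cast hi
    refine le_trans ?_ (add_le_add_left (le_max_left _ _) _)
    simp only [growthSeq]
    rw [homEntropy_div hi, hmz, ← add_div, ← mul_div_assoc, ← mul_div_assoc, ← add_div, ← add_div,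
      ← add_assoc]
    gcongr
    exact hvle _

/-! ### The maximum and its normalization to probability vectors -/

theorem exists_isMax_homEntropy (hX : IsCoplanar X η) {c₀ : Fin m → ℝ} (hc₀ : ∀ j, 0 ≤ c₀ j)
    (hcθ : ∑ j, c₀ j • toEuclid (X j) = θ) :
    ∃ c : Fin m → ℝ, (∀ j, 0 ≤ c j) ∧ ∑ j, c j • toEuclid (X j) = θ ∧
      ∀ d : Fin m → ℝ, (∀ j, 0 ≤ d j) → ∑ j, d j • toEuclid (X j) = θ →
        homEntropy d ≤ homEntropy c := by
  have hcont : Continuous fun d : Fin m → ℝ => ∑ j, d j • toEuclid (X j) := by fun_prop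
  have hcpt : IsCompact ((Set.univ.pi fun _ : Fin m => Set.Icc 0 (inner ℝ η θ)) ∩
      {d : Fin m → ℝ | ∑ j, d j • toEuclid (X j) = θ}) :=
    (isCompact_univ_pi fun _ => isCompact_Icc).inter_right (isClosed_eq hcont continuous_const)
  have hmem : ∀ d : Fin m → ℝ, (∀ j, 0 ≤ d j) → ∑ j, d j • toEuclid (X j) = θ →
      d ∈ (Set.univ.pi fun _ : Fin m => Set.Icc 0 (inner ℝ η θ)) ∩
        {d : Fin m → ℝ | ∑ j, d j • toEuclid (X j) = θ} := by
    refine fun d hd hdθ => ⟨fun j _ => ⟨hd j, ?_⟩, hdθ⟩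
    rw [← hdθ, inner_sum_eq hX]
    exact Finset.single_le_sum (fun i _ => hd i) (Finset.mem_univ j)
  obtain ⟨c, hc, hmax⟩ := hcpt.exists_isMaxOn ⟨c₀, hmem c₀ hc₀ hcθ⟩
    continuous_homEntropy.continuousOn
  exact ⟨c, fun j => (hc.1 j trivial).1, hc.2, fun d hd hdθ => hmax (hmem d hd hdθ)⟩

/-- Every representation of `θ` has total mass `⟨η, θ⟩`, so scaling matches representations of `θ`
with probability vectors and multiplies `homEntropy` by the same factor. -/
theorem isGreatest_entropySet (hX : IsCoplanar X η) (hpos : 0 < inner ℝ η θ) {c : Fin m → ℝ}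
    (hc : ∀ j, 0 ≤ c j) (hcθ : ∑ j, c j • toEuclid (X j) = θ)
    (hmax : ∀ d : Fin m → ℝ, (∀ j, 0 ≤ d j) → ∑ j, d j • toEuclid (X j) = θ →
      homEntropy d ≤ homEntropy c) :
    IsGreatest (entropySet X ((inner ℝ η θ)⁻¹ • θ)) ((inner ℝ η θ)⁻¹ * homEntropy c) := by
  have hsum : ∑ j, c j = inner ℝ η θ := by rw [← hcθ, inner_sum_eq hX]
  set t : ℝ := inner ℝ η θ
  have hinv : 0 < t⁻¹ := inv_pos.2 hpos
  have hscale : ∀ (r : ℝ) (d : Fin m → ℝ),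
      ∑ j, (r • d) j • toEuclid (X j) = r • ∑ j, d j • toEuclid (X j) := by
    intro r d
    rw [Finset.smul_sum]
    exact Finset.sum_congr rfl fun j _ => by rw [Pi.smul_apply, smul_smul, smul_eq_mul]
  refine ⟨⟨t⁻¹ • c, ⟨fun j => mul_nonneg hinv.le (hc j), ?_⟩, ?_, ?_⟩, ?_⟩
  · simp only [Pi.smul_apply, smul_eq_mul, ← Finset.mul_sum, hsum]
    exact inv_mul_cancel₀ hpos.ne'
  · rw [hscale, hcθ]
  · rw [← homEntropy_smul hinv, homEntropy_eq_entropy]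
    simp only [Pi.smul_apply, smul_eq_mul, ← Finset.mul_sum, hsum]
    exact inv_mul_cancel₀ hpos.ne'
  · rintro _ ⟨p, ⟨hp0, hp1⟩, hpθ, rfl⟩
    rw [← homEntropy_eq_entropy hp1, le_inv_mul_iff₀ hpos, ← homEntropy_smul hpos]
    refine hmax _ (fun j => mul_nonneg hpos.le (hp0 j)) ?_
    rw [hscale, hpθ, smul_inv_smul₀ hpos.ne']

end LatticeWalk

open LatticeWalk in
theorem mainTheorem3 {m s : ℕ} (X : Fin m → Fin s → ℤ)
    (η : EuclideanSpace ℝ (Fin s)) (hX : IsCoplanar X η)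
    (θ : EuclideanSpace ℝ (Fin s)) (hθ : ‖θ‖ = 1) (hθX : θ ∈ cone X) :
    Tendsto (growthSeq X θ) atTop (𝓝 (directionalGrowth X θ)) ∧
      0 < inner ℝ θ η ∧
      (entropySet X ((inner ℝ θ η)⁻¹ • θ)).Nonempty ∧
      BddAbove (entropySet X ((inner ℝ θ η)⁻¹ • θ)) ∧
      directionalGrowth X θ = inner ℝ θ η * sSup (entropySet X ((inner ℝ θ η)⁻¹ • θ)) := by
  obtain ⟨c₀, hc₀, hcθ₀⟩ := hθX
  have hpos : 0 < inner ℝ η θ := by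
    rw [hcθ₀, inner_sum_eq hX]
    -- Zero total mass would force every `c₀ j = 0`, hence `θ = 0`.
    refine (Finset.sum_nonneg fun j _ => hc₀ j).lt_of_ne' fun h => ?_
    rw [Finset.sum_eq_zero_iff_of_nonneg fun j _ => hc₀ j] at h
    have : θ = 0 := by
      rw [hcθ₀]
      exact Finset.sum_eq_zero fun j hj => by rw [h j hj, zero_smul]
    simp [this] at hθ
  obtain ⟨c, hc, hcθ, hmax⟩ := exists_isMax_homEntropy hX hc₀ hcθ₀.symm
  have hlim := tendsto_growthSeq hX hc hcθ hpos hmax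
  have hgr := isGreatest_entropySet hX hpos hc hcθ hmax
  have hdir : directionalGrowth X θ = homEntropy c := hlim.limUnder_eq
  rw [real_inner_comm]
  refine ⟨hdir ▸ hlim, hpos, hgr.nonempty, ⟨_, hgr.2⟩, ?_⟩
  rw [hgr.csSup_eq, hdir, mul_inv_cancel_left₀ hpos.ne']
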